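/- Let $T=(V,E)$ be a finite tree. For a labeling $y:V\to\{-1,+1\}$ let $\Phi_T(y)$ be the number of edges whose endpoints have different labels. For $L\subseteq V$ let $L^+$ be $L$ together with all fork nodes generated by $L$, i.e. all nodes $i\in V\setminus L$ that are connected to three distinct nodes of $L$ through pairwise edge-disjoint paths; $L$ is 0-forked if $L^+=L$. For an integer $K\ge 0$ let $\Upsilon(L,K)$ be the sum of the sizes of the $K$ largest connected components of $T\setminus L$ (and $|V\setminus L|$ if there are fewer than $K$ components). A prediction algorithm $P$ (possibly randomized) receives a query set $L\subseteq V$ and the labels of the nodes of $L$, and predicts all other labels. Let $m_P(L,y)$ be its (expected) number of mistakes on $V\setminus L$, and $m_P(L,K)=\max_{y:\Phi_T(y)\le K} m_P(L,y)$. A selection algorithm $S$ outputs, for each budget $Q$, a query set $L_{S(Q)}\subseteq V$ of at most $Q$ nodes. Put $$[q+m]_{\langle S,P\rangle}=\min_{Q\ge 1}\bigl(Q+m_P(L_{S(Q)},K)\bigr),\qquad [q+m]_{\mathrm{OPT}}=\inf_{S,P}\,[q+m]_{\langle S,P\rangle}.$$ Both $S$ and $P$ may depend on $T$ and $K$. SEL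 starts from $L_0=\emptyset$; in step $t=1,2,\dots,|V|$ it takes a largest component $T^t_{\max}$ of $T\setminus L_{t-1}$, selects a node $i_t$ of it that minimizes the size of the largest component of $T^t_{\max}\setminus\{i_t\}$, and sets $L_t=L_{t-1}\cup\{i_t\}$. Given $K$, SEL$^\star$ finds the smallest $t^*\in\{1,\dots,|V|\}$ minimizing $t+\Upsilon(L_t^+,K)$ and outputs $L_{\mathrm{SEL}^\star}=L_{t^*}$. PRED runs on a nonempty 0-forked query set $L$. Each component $C$ of $T\setminus L$ has one or two connection nodes (nodes of $L$ adjacent to $C$). If these have a common label, PRED predicts it on all of $C$; otherwise it predicts the label of the closer connection node, where either one label (that of either connection node) is used for the whole of $C$, or each node of $C$ is predicted with the label of a connection node closest to it. All ties are broken arbitrarily. **Theorem.** There is a universal constant $c$ such that for every finite tree $T$, every cutsize budget $K\ge 0$, and every way of breaking ties in SEL and PRED, $$|L_{\mathrm{SEL}^\star}|+m_{\mathrm{PRED}}(L_{\mathrm{SEL}^\star}^+,K)\le c\,[q+m]_{\mathrm{OPT}}\quad\text{and also}\quad |L_{\mathrm{SEL}^\star}^+|+m_{\mathrm{PRED}}(L_{\mathrm{SEL}^\star}^+,K)\le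 c\,[q+m]_{\mathrm{OPT}}.$$ -/

import Mathlib

namespace ActiveTree

variable {V : Type*} [Fintype V]

/-! ### Labelings, cutsize, components -/

/-- The cutsize of a binary labeling `y`: the number of edges whose endpoints have different
labels. -/
noncomputable def cutsize (T : SimpleGraph V) (y : V → Bool) : ℕ :=
  {e : Sym2 V | e ∈ T.edgeSet ∧ ∃ i j : V, e = s(i, j) ∧ y i ≠ y j}.ncard

open Classical in
/-- The node set of the connected component of the forest `T \ S` that contains `v`, i.e. the
set of nodes joined to `v` by a walk that avoids `S` (empty if `v ∈ S`). -/
noncomputable def component (T : SimpleGraph V) (S : Finset V) (v : V) : Finset V :=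
  Finset.univ.filter fun w => ∃ p : T.Walk v w, ∀ x ∈ p.support, x ∉ S

open Classical in
/-- The node sets of the connected components of the forest `T \ S`. -/
noncomputable def components (T : SimpleGraph V) (S : Finset V) : Finset (Finset V) :=
  Sᶜ.image (component T S)

open Classical in
/-- `σ(T', i)` for the subtree `T'` of `T` with node set `C`: the size of the largest component
of `T' \ {i}` (zero if there is none). Removing `i` from `T'` is the same as removing `i` and
all nodes outside `C` from `T`. -/
noncomputable def sigma (T : SimpleGraph V) (C : Finset V) (i : V) : ℕ :=
  (components T (insert i Cᶜ)).sup Finset.card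

open Classical in
/-- The component function `Υ(L, K)`: the largest total size of at most `K` distinct components
of `T \ L`, that is, the sum of the sizes of the `K` largest components, and `|V \ L|` if there
are fewer than `K` components. -/
noncomputable def upsilon (T : SimpleGraph V) (L : Finset V) (K : ℕ) : ℕ :=
  ((components T L).powerset.filter fun A => A.card ≤ K).sup fun A => ∑ C ∈ A, C.card

/-! ### Fork nodes -/

open Classical in
/-- The fork nodes generated by `L`: the nodes outside `L` that are connected to three distinct
nodes of `L` through pairwise edge-disjoint paths. -/
noncomputable def fork (T : SimpleGraph V) (L : Finset V) : Finset V :=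
  Finset.univ.filter fun i => i ∉ L ∧
    ∃ i₁ ∈ L, ∃ i₂ ∈ L, ∃ i₃ ∈ L, i₁ ≠ i₂ ∧ i₁ ≠ i₃ ∧ i₂ ≠ i₃ ∧
      ∃ (p₁ : T.Path i i₁) (p₂ : T.Path i i₂) (p₃ : T.Path i i₃),
        p₁.1.edges.Disjoint p₂.1.edges ∧ p₁.1.edges.Disjoint p₃.1.edges ∧
          p₂.1.edges.Disjoint p₃.1.edges

open Classical in
/-- `L⁺`: the query set `L` together with all fork nodes generated by `L`. -/
noncomputable def plus (T : SimpleGraph V) (L : Finset V) : Finset V :=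
  L ∪ fork T L

/-- `L` is 0-forked if `L⁺ = L`. -/
def IsZeroForked (T : SimpleGraph V) (L : Finset V) : Prop :=
  plus T L = L

/-! ### The selection algorithm `SEL` and its modification `SEL⋆` -/

open Classical in
/-- `L_t`: the first `t` nodes `i 0, …, i (t - 1)` of the sequence `i`. -/
noncomputable def firstNodes (i : ℕ → V) (t : ℕ) : Finset V :=
  (Finset.range t).image i

/-- `C` is the node set of a largest component of `T \ S`. -/
def IsLargestComponent (T : SimpleGraph V) (S C : Finset V) : Prop :=
  C ∈ components T S ∧ ∀ D ∈ components T S, D.card ≤ C.card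

/-- The sequence `i` is an execution of `SEL` (with arbitrary resolution of ties) until all nodes
are selected: in each step a largest component of the current forest is taken, and a node of it
is selected that minimizes the size of the largest component left after its removal. -/
def IsSelRun (T : SimpleGraph V) (i : ℕ → V) : Prop :=
  ∀ t < Fintype.card V, ∃ C : Finset V, IsLargestComponent T (firstNodes i t) C ∧
    i t ∈ C ∧ ∀ j ∈ C, sigma T C (i t) ≤ sigma T C j

/-- The number `t` of nodes chosen by `SEL⋆` from the execution `i` of `SEL` for the cutsize
budget `K`: the smallest minimizer of `t + Υ(L_t⁺, K)` over `1 ≤ t ≤ |V|`. -/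
def IsSelStarSize (T : SimpleGraph V) (K : ℕ) (i : ℕ → V) (t : ℕ) : Prop :=
  IsLeast {t : ℕ | 1 ≤ t ∧ t ≤ Fintype.card V ∧
    ∀ s : ℕ, 1 ≤ s → s ≤ Fintype.card V →
      t + upsilon T (plus T (firstNodes i t)) K ≤ s + upsilon T (plus T (firstNodes i s)) K} t

/-! ### Prediction algorithms and mistakes -/

/-- A (possibly randomized) prediction algorithm: given a query set `L` and the labels of the
nodes in `L`, and nothing else about the labeling, it draws a prediction of all labels. -/
abbrev Predictor (V : Type*) : Type _ :=
  (L : Finset V) → (L → Bool) → PMF (V → Bool)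

open Classical in
/-- The number of mistakes of the prediction `z` on `V \ L` if the labeling is `y`. -/
noncomputable def numMistakes (L : Finset V) (y z : V → Bool) : ℕ :=
  (Finset.univ.filter fun v => v ∉ L ∧ z v ≠ y v).card

open Classical in
/-- `m_P(L, y)`: the (expected) number of mistakes of `P` on `V \ L` with query set `L` if the
labeling is `y`. -/
noncomputable def mistakes (P : Predictor V) (L : Finset V) (y : V → Bool) : ℝ :=
  ∑ z : V → Bool, (P L (fun v => y v) z).toReal * numMistakes L y z

/-- `m_P(L, K)`: the maximum of `m_P(L, y)` over the labelings `y` with cutsize at most `K`. -/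
noncomputable def worstMistakes (T : SimpleGraph V) (P : Predictor V) (L : Finset V) (K : ℕ) :
    ℝ :=
  ⨆ y : {y : V → Bool // cutsize T y ≤ K}, mistakes P L y.1

/-- `u` is a connection node of the component `C` of `T \ L`. -/
def IsConnectionNode (T : SimpleGraph V) (L C : Finset V) (u : V) : Prop :=
  u ∈ L ∧ ∃ v ∈ C, T.Adj u v

/-- `P` is the algorithm `PRED`, with arbitrary resolution of ties. It is run on nonempty 0-forked
query sets `L`, for which the components `C` of `T \ L` are the hinge-trees. If the connection
nodes of `C` (one or two) have one and the same label, then all nodes of `C` are predicted with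
it. If they have different labels, the label of the closer connection node is predicted; both
readings of this are admitted: one label for the whole of `C` (whose distance to either
connection node is one), or, for every node of `C`, the label of a connection node closest to
that node. -/
def IsPred (T : SimpleGraph V) (P : Predictor V) : Prop :=
  ∀ (L : Finset V) (l : L → Bool), L.Nonempty → IsZeroForked T L →
    ∀ z ∈ (P L l).support, ∀ C ∈ components T L,
      (∃ u : L, IsConnectionNode T L C u ∧ ∀ v ∈ C, z v = l u) ∨
      (∀ v ∈ C, ∃ u : L, IsConnectionNode T L C u ∧
        (∀ u' : L, IsConnectionNode T L C u' → T.dist v u ≤ T.dist v u') ∧ z v = l u)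

/-! ### The optimal value of queries plus mistakes -/

/-- A selection algorithm: for every query budget `Q` a query set of at most `Q` nodes. It is
arbitrary otherwise, and may in particular depend on the tree and on the cutsize budget. -/
abbrev Selector (V : Type*) : Type _ :=
  (Q : ℕ) → {L : Finset V // L.card ≤ Q}

/-- `[q+m]_⟨S,P⟩`: the minimum over `Q ≥ 1` of `Q + m_P(L_{S(Q)}, K)`. -/
noncomputable def qm (T : SimpleGraph V) (K : ℕ) (S : Selector V) (P : Predictor V) : ℝ :=
  ⨅ Q : {Q : ℕ // 1 ≤ Q}, ((Q.1 : ℝ) + worstMistakes T P (S Q.1).1 K)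

/-- `[q+m]_OPT`: the infimum of `[q+m]_⟨S,P⟩` over all pairs of selection and prediction
algorithms. -/
noncomputable def qmOpt (T : SimpleGraph V) (K : ℕ) : ℝ :=
  ⨅ A : Selector V × Predictor V, qm T K A.1 A.2

end ActiveTree

namespace ActiveTree

section
variable {V : Type*} [Fintype V] {T : SimpleGraph V} {S S' C D L M A : Finset V}
  {u v w f a b : V}
open scoped Classical

/-! ### Components and connected sets -/

/-! The function Υ controls mistakes from both sides, and the greedy centroid choice controls Υ.
Lower bound (`upsilon_le_two_mul_worstMistakes`): a component of the forest left by the 0-forked set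
L⁺ is joined to the rest by at most two edges (`card_boundary_le`). Take components attaining Υ(L⁺,
K), give at most one boundary edge of each to the cut of one labeling and the remaining one to the
cut of another. Both cutsizes are at most K, and the labelings agree on L and differ exactly on the
chosen components, so every prediction errs there on one of them at each node. Hence Υ(L⁺, K) ≤ 2m
for every predictor. Upper bound (`worstMistakes_le_upsilon`): on a nonempty 0-forked L, `PRED` errs
only in components touched by a cut edge; there are at most K of these, so it makes at most Υ(L, K)
mistakes. Selection (`IsSelRun.upsilon_le`): let s be the largest component size after t ≥ 4|M|
steps. Every split was at a centroid of a component with at least s nodes, and a potential argument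
(`IsSelRun.exists_regions`) yields at least t/2 ≥ 2|M| disjoint connected regions of size at least
s/2. At most |M| of them meet M, so components of the current forest that meet M can be traded for
regions that avoid M, at the cost of a factor 2. This gives Υ(L_t, K) ≤ 3Υ(M, K). Since |L⁺| ≤ 2|L|
(`card_fork_le`), comparing with M = L⁺ at t = 8Q, for any competing L of at most Q nodes, finishes
the proof. -/

theorem mem_component :
    w ∈ component T S v ↔ ∃ p : T.Walk v w, ∀ x ∈ p.support, x ∉ S := by
  simp [component]

theorem self_mem_component (h : v ∉ S) : v ∈ component T S v :=
  mem_component.2 ⟨.nil, by simpa using h⟩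

theorem notMem_of_mem_component (h : w ∈ component T S v) : w ∉ S := by
  obtain ⟨p, hp⟩ := mem_component.1 h
  exact hp _ p.end_mem_support

theorem mem_component_symm (h : w ∈ component T S v) : v ∈ component T S w := by
  obtain ⟨p, hp⟩ := mem_component.1 h
  exact mem_component.2 ⟨p.reverse, by simpa using hp⟩

theorem mem_component_trans (h : v ∈ component T S u) (h' : w ∈ component T S v) :
    w ∈ component T S u := by
  obtain ⟨p, hp⟩ := mem_component.1 h
  obtain ⟨q, hq⟩ := mem_component.1 h'
  refine mem_component.2 ⟨p.append q, fun x hx => ?_⟩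
  rcases SimpleGraph.Walk.mem_support_append_iff _ _ |>.1 hx with hx | hx
  exacts [hp x hx, hq x hx]

theorem mem_component_of_adj (h : T.Adj v w) (hv : v ∉ S) (hw : w ∉ S) :
    w ∈ component T S v :=
  mem_component.2 ⟨h.toWalk, by simp [hv, hw]⟩

theorem mem_component_adj (h : v ∈ component T S u) (hvw : T.Adj v w) (hw : w ∉ S) :
    w ∈ component T S u :=
  mem_component_trans h (mem_component_of_adj hvw (notMem_of_mem_component h) hw)

theorem component_mono (h : S ⊆ S') : component T S' v ⊆ component T S v := by
  intro w hw
  obtain ⟨p, hp⟩ := mem_component.1 hw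
  exact mem_component.2 ⟨p, fun x hx hxS => hp x hx (h hxS)⟩

theorem component_eq_of_mem (h : w ∈ component T S v) : component T S w = component T S v := by
  ext x
  exact ⟨mem_component_trans h, mem_component_trans (mem_component_symm h)⟩

/-- All nodes on a walk that avoids `S` lie in the component of its endpoints. -/
theorem support_subset_component (p : T.Walk v w) (hp : ∀ x ∈ p.support, x ∉ S) {x : V}
    (hx : x ∈ p.support) : x ∈ component T S v :=
  mem_component.2 ⟨p.takeUntil x hx, fun y hy =>
    hp y (SimpleGraph.Walk.support_takeUntil_subset_support p hx hy)⟩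

/-- `A` induces a connected subgraph of `T` (or is empty). -/
def IsConn (T : SimpleGraph V) (A : Finset V) : Prop :=
  ∀ v ∈ A, A ⊆ component T Aᶜ v

theorem IsConn.subset_component (hA : IsConn T A) (hS : Disjoint A S) (hv : v ∈ A)
    (h : v ∈ component T S u) : A ⊆ component T S u := fun _ hw =>
  mem_component_trans h (component_mono (fun _ hx => Finset.mem_compl.2 fun hxA =>
    Finset.disjoint_left.1 hS hxA hx) (hA v hv hw))

theorem isConn_component : IsConn T (component T S v) := by
  intro x hx y hy
  obtain ⟨p, hp⟩ := mem_component.1 (mem_component_trans (mem_component_symm hx) hy)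
  refine mem_component.2 ⟨p, fun z hz => ?_⟩
  simpa using mem_component_trans hx (support_subset_component p hp hz)

theorem disjoint_component : Disjoint (component T S v) S :=
  Finset.disjoint_left.2 fun _ h => notMem_of_mem_component h

theorem mem_components : C ∈ components T S ↔ ∃ v ∉ S, component T S v = C := by
  simp [components]

theorem component_mem_components (h : v ∉ S) : component T S v ∈ components T S :=
  mem_components.2 ⟨v, h, rfl⟩

theorem eq_component_of_mem (hC : C ∈ components T S) (hv : v ∈ C) : C = component T S v := by
  obtain ⟨w, -, rfl⟩ := mem_components.1 hC
  exact (component_eq_of_mem hv).symm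

theorem nonempty_of_mem_components (hC : C ∈ components T S) : C.Nonempty := by
  obtain ⟨w, hw, rfl⟩ := mem_components.1 hC
  exact ⟨w, self_mem_component hw⟩

theorem isConn_of_mem_components (hC : C ∈ components T S) : IsConn T C := by
  obtain ⟨w, hw, rfl⟩ := mem_components.1 hC
  exact isConn_component

theorem disjoint_of_mem_components (hC : C ∈ components T S) : Disjoint C S := by
  obtain ⟨w, hw, rfl⟩ := mem_components.1 hC
  exact disjoint_component

theorem eq_of_mem_components (hC : C ∈ components T S) (hD : D ∈ components T S)
    (hvC : v ∈ C) (hvD : v ∈ D) : C = D := by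
  rw [eq_component_of_mem hC hvC, eq_component_of_mem hD hvD]

theorem pairwiseDisjoint_components :
    ((components T S : Finset (Finset V)) : Set (Finset V)).PairwiseDisjoint id := by
  intro C hC D hD hne
  refine Finset.disjoint_left.2 fun v hv hv' => hne (eq_of_mem_components hC hD hv hv')

theorem IsConn.exists_mem_components (hA : IsConn T A) (hne : A.Nonempty) (hS : Disjoint A S) :
    ∃ C ∈ components T S, A ⊆ C := by
  obtain ⟨v, hv⟩ := hne
  have hvS := Finset.disjoint_left.1 hS hv
  exact ⟨_, component_mem_components hvS, hA.subset_component hS hv (self_mem_component hvS)⟩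

/-- From `v`, every other node of its component is reached through a neighbor of `v`, along
which `v` is not met again. -/
theorem exists_adj_mem_component (h : w ∈ component T S v) (hne : w ≠ v) :
    ∃ a, T.Adj v a ∧ a ∈ component T (insert v S) w := by
  obtain ⟨p, hp⟩ := mem_component.1 h
  have hq : ∀ x ∈ p.bypass.support, x ∉ S := fun x hx =>
    hp x (p.support_bypass_subset_support hx)
  have hpath := p.bypass_isPath
  revert hq hpath
  generalize p.bypass = q
  intro hq hpath
  cases q with
  | nil => exact absurd rfl hne
  | cons hadj r =>
    rename_i a
    rw [SimpleGraph.Walk.cons_isPath_iff] at hpath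
    refine ⟨a, hadj, mem_component_symm (mem_component.2 ⟨r, fun x hx hxS => ?_⟩)⟩
    rcases Finset.mem_insert.1 hxS with rfl | hxS
    · exact hpath.2 hx
    · exact hq x (by simp [hx]) hxS

theorem mem_component_empty (hT : T.Connected) (v w : V) : w ∈ component T ∅ v := by
  obtain ⟨p⟩ := hT.preconnected v w
  exact mem_component.2 ⟨p, by simp⟩

theorem exists_adj_mem_component_singleton (hT : T.Connected) (h : w ≠ v) :
    ∃ a, T.Adj v a ∧ a ∈ component T {v} w := by
  simpa using exists_adj_mem_component (mem_component_empty hT v w) h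

/-- Distinct neighbors of a node of a forest are separated by this node. -/
theorem eq_of_adj_of_mem_component (hT : T.IsAcyclic) (ha : T.Adj f a) (hb : T.Adj f b)
    (h : b ∈ component T {f} a) : a = b := by
  by_contra hne
  obtain ⟨p, hp⟩ := mem_component.1 h
  have hpath : (SimpleGraph.Walk.cons ha.symm hb.toWalk).IsPath := by
    simp [SimpleGraph.Walk.cons_isPath_iff, ha.ne', hb.ne, hne]
  have heq := (hT.subsingleton_path _ _).elim ⟨_, p.bypass_isPath⟩ ⟨_, hpath⟩
  have h1 : p.bypass = SimpleGraph.Walk.cons ha.symm hb.toWalk := congrArg Subtype.val heq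
  have h2 : f ∈ p.bypass.support := by rw [h1]; simp
  exact hp f (p.support_bypass_subset_support h2) (by simp)

/-! ### Fork nodes -/

/-- A fork node of `L` is a node outside `L` that separates three nodes of `L`. -/
theorem mem_fork (hT : T.IsTree) : f ∈ fork T L ↔
    f ∉ L ∧ 2 < (L.image (component T {f})).card := by
  rw [Finset.two_lt_card]
  simp only [fork, Finset.mem_filter, Finset.mem_univ, true_and]
  refine and_congr_right fun hf => ⟨?_, ?_⟩
  · rintro ⟨i, hi, j, hj, k, hk, -, -, -, p, q, r, hpq, hpr, hqr⟩
    -- The first edge of a path from `f` leads to the neighbor of `f` on the side of the target.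
    -- Targets on one side therefore force a common first edge.
    have key : ∀ {i j : V}, i ∈ L → j ∈ L → ∀ (p : T.Path f i) (q : T.Path f j),
        p.1.edges.Disjoint q.1.edges → component T {f} i ≠ component T {f} j := by
      rintro i j hi hj ⟨p, hp⟩ ⟨q, hq⟩ hd he
      cases p with
      | nil => exact hf hi
      | cons ha p =>
        cases q with
        | nil => exact hf hj
        | cons hb q =>
          rename_i a b
          rw [SimpleGraph.Walk.cons_isPath_iff] at hp hq
          have h1 : i ∈ component T {f} a :=
            mem_component.2 ⟨p, fun x hx hxf => hp.2 (by simp at hxf; exact hxf ▸ hx)⟩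
          have h2 : j ∈ component T {f} b :=
            mem_component.2 ⟨q, fun x hx hxf => hq.2 (by simp at hxf; exact hxf ▸ hx)⟩
          have h3 : b ∈ component T {f} a := by
            rw [component_eq_of_mem h1, component_eq_of_mem h2] at he
            rw [he]
            exact self_mem_component (by simpa using hb.ne')
          obtain rfl := eq_of_adj_of_mem_component hT.isAcyclic ha hb h3
          exact hd (a := s(f, a)) (by simp) (by simp)
    exact ⟨_, Finset.mem_image_of_mem _ hi, _, Finset.mem_image_of_mem _ hj, _,
      Finset.mem_image_of_mem _ hk, key hi hj p q hpq, key hi hk p r hpr, key hj hk q r hqr⟩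
  · rintro ⟨_, hi, _, hj, _, hk, hij, hik, hjk⟩
    obtain ⟨i, hiL, rfl⟩ := Finset.mem_image.1 hi
    obtain ⟨j, hjL, rfl⟩ := Finset.mem_image.1 hj
    obtain ⟨k, hkL, rfl⟩ := Finset.mem_image.1 hk
    have hnode : ∀ {i : V} (p : T.Walk f i), p.IsPath → ∀ x ∈ p.support, x ≠ f →
        x ∈ component T {f} i := by
      intro i p hp x hx hxf
      cases p with
      | nil => simp at hx; exact absurd hx hxf
      | cons ha p =>
        rw [SimpleGraph.Walk.cons_isPath_iff] at hp
        have hpf : ∀ y ∈ p.support, y ∉ ({f} : Finset V) := fun y hy hyf => by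
          simp at hyf; exact hp.2 (hyf ▸ hy)
        have hx' : x ∈ p.support := by simpa [hxf] using hx
        exact mem_component_trans (mem_component_symm (mem_component.2 ⟨p, hpf⟩))
          (support_subset_component p hpf hx')
    -- A common edge has an end other than `f`, and this end would lie on the sides of both targets.
    have key : ∀ {i j : V}, component T {f} i ≠ component T {f} j → ∀ (p : T.Path f i)
        (q : T.Path f j), p.1.edges.Disjoint q.1.edges := by
      rintro i j hne ⟨p, hp⟩ ⟨q, hq⟩ e hep heq
      induction e with
      | _ x y =>
        have hxy := p.adj_of_mem_edges hep
        obtain ⟨z, hzf, hzp, hzq⟩ : ∃ z, z ≠ f ∧ z ∈ p.support ∧ z ∈ q.support := by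
          by_cases hx : x = f
          · exact ⟨y, fun h => hxy.ne (hx.trans h.symm),
              p.snd_mem_support_of_mem_edges hep, q.snd_mem_support_of_mem_edges heq⟩
          · exact ⟨x, hx, p.fst_mem_support_of_mem_edges hep, q.fst_mem_support_of_mem_edges heq⟩
        exact hne ((component_eq_of_mem (hnode p hp z hzp hzf)).symm.trans
          (component_eq_of_mem (hnode q hq z hzq hzf)))
    have hpath : ∀ i, Nonempty (T.Path f i) := fun i => by
      obtain ⟨p⟩ := hT.connected.preconnected f i
      exact ⟨p.toPath⟩
    obtain ⟨p⟩ := hpath i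
    obtain ⟨q⟩ := hpath j
    obtain ⟨r⟩ := hpath k
    exact ⟨i, hiL, j, hjL, k, hkL, fun h => hij (h ▸ rfl), fun h => hik (h ▸ rfl),
      fun h => hjk (h ▸ rfl), p, q, r, key hij p q, key hik p r, key hjk q r⟩

/-- If `f` separates two nodes of `L`, then it can be joined to one of them without meeting a
given other node. -/
theorem exists_mem_component_of_separated (hT : T.Connected) (hf : f ∉ L)
    (h : 1 < (L.image (component T {f})).card) (hv : v ≠ f) :
    ∃ i ∈ L, i ∈ component T {v} f := by
  obtain ⟨_, hi, _, hj, hij⟩ := Finset.one_lt_card.1 h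
  obtain ⟨i, hiL, rfl⟩ := Finset.mem_image.1 hi
  obtain ⟨j, hjL, rfl⟩ := Finset.mem_image.1 hj
  have key : ∀ i ∈ L, v ∉ component T {f} i → i ∈ component T {v} f := by
    intro i hi hvi
    have hif : i ≠ f := fun h => hf (h ▸ hi)
    obtain ⟨a, hfa, ha⟩ := exists_adj_mem_component_singleton hT hif
    have hav : a ≠ v := fun h => hvi (h ▸ ha)
    have h1 : a ∈ component T {v} f := mem_component_of_adj hfa (by simpa using hv.symm)
      (by simpa using hav)
    refine isConn_component.subset_component (S := {v}) ?_ ha h1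
      (self_mem_component (by simpa using hif))
    simpa using hvi
  -- `v` lies on at most one of the two sides; the other one is reached from `f` without meeting
  -- `v`.
  by_cases hvi : v ∈ component T {f} i
  · refine ⟨j, hjL, key j hjL fun hvj => hij ?_⟩
    rw [← component_eq_of_mem hvi, ← component_eq_of_mem hvj]
  · exact ⟨i, hiL, key i hiL hvi⟩

/-- A side of `f` that contains a fork node of `L` already contains a node of `L`, by
`exists_mem_component_of_separated`. So fork nodes add no new sides to a node outside `plus T L`. -/
theorem isZeroForked_plus (hT : T.IsTree) : IsZeroForked T (plus T L) := by
  rw [IsZeroForked, plus, Finset.union_eq_left]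
  intro f hf
  rw [mem_fork hT] at hf
  obtain ⟨hfL, hcard⟩ := hf
  by_contra hfL'
  refine hfL' (Finset.mem_union_right _ ((mem_fork hT).2
    ⟨fun h => hfL' (Finset.mem_union_left _ h), hcard.trans_le (Finset.card_le_card ?_)⟩))
  intro D hD
  obtain ⟨j, hj, rfl⟩ := Finset.mem_image.1 hD
  rcases Finset.mem_union.1 hj with hjL | hjf
  · exact Finset.mem_image_of_mem _ hjL
  · have hne : f ≠ j := fun h => hfL' (h ▸ hj)
    have hjf' := (mem_fork hT).1 hjf
    obtain ⟨i, hi, hij⟩ := exists_mem_component_of_separated hT.connected hjf'.1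
      (by omega) hne
    exact Finset.mem_image.2 ⟨i, hi, component_eq_of_mem hij⟩

/-- Adding one node `v` to `L` creates at most one fork node: from a new fork node, `v` is the only
queried node on its side, and this happens at one branching point only. -/
theorem card_fork_le (hT : T.IsTree) (L : Finset V) : (fork T L).card ≤ L.card := by
  induction L using Finset.induction with
  | empty =>
    rw [Finset.card_empty, Nat.le_zero, Finset.card_eq_zero, Finset.eq_empty_iff_forall_notMem]
    intro f hf
    simpa using ((mem_fork hT).1 hf).2
  | insert v L hv ih =>
    have hnew : (fork T (insert v L) \ fork T L).card ≤ 1 := by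
      have key : ∀ f ∈ fork T (insert v L) \ fork T L, f ≠ v ∧ f ∉ L ∧
          1 < (L.image (component T {f})).card ∧ ∀ i ∈ L, i ∉ component T {f} v := by
        intro f hf
        obtain ⟨hf1, hf2⟩ := Finset.mem_sdiff.1 hf
        rw [mem_fork hT] at hf1 hf2
        obtain ⟨hfL, hcard⟩ := hf1
        rw [Finset.mem_insert, not_or] at hfL
        rw [Finset.image_insert] at hcard
        have h2 : ¬ 2 < (L.image (component T {f})).card := fun h => hf2 ⟨hfL.2, h⟩
        have h3 : component T {f} v ∉ L.image (component T {f}) := fun h => by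
          rw [Finset.insert_eq_of_mem h] at hcard; exact h2 hcard
        rw [Finset.card_insert_of_notMem h3] at hcard
        exact ⟨hfL.1, hfL.2, by omega, fun i hi hiv =>
          h3 (Finset.mem_image.2 ⟨i, hi, component_eq_of_mem hiv⟩)⟩
      -- If `g` were on the side of `f` containing `v`, so would be some node of `L`. Hence `f` lies
      -- on the path from `v` to `g`; by symmetry two new fork nodes would each be closer to `v`
      -- than the other.
      have hdist : ∀ f ∈ fork T (insert v L) \ fork T L, ∀ g ∈ fork T (insert v L) \ fork T L,
          f ≠ g → T.dist v f < T.dist v g := by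
        intro f hf g hg hne
        obtain ⟨hfv, -, -, hf⟩ := key f hf
        obtain ⟨hgv, hgL, hgc, -⟩ := key g hg
        have hgf : g ∉ component T {f} v := fun h => by
          obtain ⟨i, hi, hig⟩ := exists_mem_component_of_separated hT.connected hgL hgc hne
          exact hf i hi (mem_component_trans h hig)
        obtain ⟨p, hp, hlen⟩ := hT.connected.exists_path_of_dist v g
        have hfp : f ∈ p.support := by
          by_contra hfp
          exact hgf (mem_component.2 ⟨p, fun x hx hxf => hfp (by simp at hxf; exact hxf ▸ hx)⟩)
        rw [← hlen]
        exact (SimpleGraph.dist_le _).trans_lt (SimpleGraph.Walk.length_takeUntil_lt_length hfp hne)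
      refine Finset.card_le_one.2 fun f hf g hg => ?_
      by_contra hne
      exact lt_asymm (hdist f hf g hg hne) (hdist g hg f hf (Ne.symm hne))
    calc (fork T (insert v L)).card
        ≤ (fork T (insert v L) \ fork T L).card + (fork T L).card := by
          have := Finset.le_card_sdiff (fork T L) (fork T (insert v L)); omega
      _ ≤ (insert v L).card := by rw [Finset.card_insert_of_notMem hv]; omega

theorem card_plus_le (hT : T.IsTree) (L : Finset V) : (plus T L).card ≤ 2 * L.card :=
  (Finset.card_union_le _ _).trans (by have := card_fork_le hT L; omega)

end

/-! ### Disjoint families and prefixes of a selection sequence -/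

section
variable {V : Type*}
open scoped Classical

theorem firstNodes_nonempty {i : ℕ → V} {t : ℕ} (ht : 1 ≤ t) : (firstNodes i t).Nonempty :=
  ⟨i 0, Finset.mem_image_of_mem i (Finset.mem_range.2 ht)⟩

/-- At most `|M|` members of a disjoint family meet `M`. -/
theorem card_filter_not_disjoint_le {F : Finset (Finset V)}
    (hF : (F : Set (Finset V)).PairwiseDisjoint id) (M : Finset V) :
    (F.filter fun R => ¬ Disjoint R M).card ≤ M.card := by
  -- `choose!` below needs a default node.
  rcases isEmpty_or_nonempty V with hV | hV
  · rw [Finset.card_eq_zero.2 (Finset.filter_eq_empty_iff.2 fun R _ => not_not.2 ?_)]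
    · exact Nat.zero_le _
    · exact Finset.disjoint_left.2 fun x => hV.elim x
  have h : ∀ R ∈ F.filter fun R => ¬ Disjoint R M, ∃ x ∈ M, x ∈ R := fun R hR => by
    obtain ⟨x, hx, hxM⟩ := Finset.not_disjoint_iff.1 (Finset.mem_filter.1 hR).2
    exact ⟨x, hxM, hx⟩
  choose! g hg hgR using h
  refine Finset.card_le_card_of_injOn g hg fun R hR R' hR' he => ?_
  by_contra hne
  have hd := hF (Finset.filter_subset _ _ hR) (Finset.filter_subset _ _ hR') hne
  exact Finset.disjoint_left.1 hd (hgR R hR) (he ▸ hgR R' hR')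

theorem firstNodes_succ (i : ℕ → V) (t : ℕ) :
    firstNodes i (t + 1) = insert (i t) (firstNodes i t) := by
  simp [firstNodes, Finset.range_add_one]

theorem firstNodes_mono (i : ℕ → V) : Monotone (firstNodes i) := fun _ _ h =>
  Finset.image_subset_image (Finset.range_mono h)

theorem card_firstNodes_le (i : ℕ → V) (t : ℕ) : (firstNodes i t).card ≤ t :=
  Finset.card_image_le.trans (by simp)

end

section
variable {V : Type*} [Fintype V] {T : SimpleGraph V} {S S' C D L M A : Finset V}
  {u v w f a b : V}
open scoped Classical

/-! ### The component function -/

/-- The sizes of at most `K` disjoint connected sets that avoid `L` add up to at most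
`upsilon T L K`. -/
theorem sum_card_le_upsilon {K : ℕ} {F : Finset (Finset V)}
    (hF : (F : Set (Finset V)).PairwiseDisjoint id) (hK : F.card ≤ K)
    (hc : ∀ R ∈ F, IsConn T R ∧ R.Nonempty ∧ Disjoint R L) :
    ∑ R ∈ F, R.card ≤ upsilon T L K := by
  choose! g hg hsub using fun R hR =>
    (hc R hR).1.exists_mem_components (hc R hR).2.1 (hc R hR).2.2
  have hmem : F.image g ∈ (components T L).powerset.filter fun A => A.card ≤ K := by
    rw [Finset.mem_filter, Finset.mem_powerset]
    exact ⟨Finset.image_subset_iff.2 hg, Finset.card_image_le.trans hK⟩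
  refine le_trans ?_ (Finset.le_sup (f := fun A : Finset (Finset V) => ∑ C ∈ A, C.card) hmem)
  -- Several members of `F` may lie in one component; being disjoint, they are jointly no larger
  -- than it.
  rw [← Finset.sum_fiberwise_of_maps_to (fun R hR => Finset.mem_image_of_mem g hR)]
  refine Finset.sum_le_sum fun D _ => ?_
  have := Finset.card_biUnion (s := F.filter fun R => g R = D) (t := id)
    (fun R hR R' hR' h => hF (Finset.filter_subset _ _ hR) (Finset.filter_subset _ _ hR') h)
  simp only [id] at this
  rw [← this]
  refine Finset.card_le_card (Finset.biUnion_subset.2 fun R hR => ?_)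
  obtain ⟨hRF, rfl⟩ := Finset.mem_filter.1 hR
  exact hsub R hRF

theorem upsilon_le {K m : ℕ} (h : ∀ A ⊆ components T L, A.card ≤ K → ∑ C ∈ A, C.card ≤ m) :
    upsilon T L K ≤ m :=
  Finset.sup_le fun A hA => by
    rw [Finset.mem_filter, Finset.mem_powerset] at hA
    exact h A hA.1 hA.2

theorem exists_upsilon_eq (T : SimpleGraph V) (L : Finset V) (K : ℕ) :
    ∃ A ⊆ components T L, A.card ≤ K ∧ ∑ C ∈ A, C.card = upsilon T L K := by
  have hne : ((components T L).powerset.filter fun A => A.card ≤ K).Nonempty :=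
    ⟨∅, by simp⟩
  obtain ⟨A, hA, h⟩ := Finset.exists_mem_eq_sup _ hne
    (fun A : Finset (Finset V) => ∑ C ∈ A, C.card)
  rw [Finset.mem_filter, Finset.mem_powerset] at hA
  exact ⟨A, hA.1, hA.2, h.symm⟩

theorem upsilon_anti {K : ℕ} (h : L ⊆ M) : upsilon T M K ≤ upsilon T L K :=
  upsilon_le fun _ hA hK => sum_card_le_upsilon (pairwiseDisjoint_components.subset hA) hK
    fun _ hR => ⟨isConn_of_mem_components (hA hR), nonempty_of_mem_components (hA hR),
      (disjoint_of_mem_components (hA hR)).mono_right h⟩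

/-! ### Centroids -/

theorem subset_of_mem_components_insert_compl (hD : D ∈ components T (insert v Cᶜ)) :
    D ⊆ C ∧ v ∉ D := by
  have h := disjoint_of_mem_components hD
  rw [Finset.disjoint_insert_right, ← le_compl_iff_disjoint_right, compl_compl] at h
  exact ⟨h.2, h.1⟩

theorem IsConn.exists_adj (hC : IsConn T C) (hv : v ∈ C) (hD : D ∈ components T (insert v Cᶜ)) :
    ∃ a ∈ D, T.Adj v a := by
  obtain ⟨w, hw⟩ := nonempty_of_mem_components hD
  obtain ⟨hDC, hvD⟩ := subset_of_mem_components_insert_compl hD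
  obtain ⟨a, hva, ha⟩ := exists_adj_mem_component (hC v hv (hDC hw))
    (fun h => hvD (h ▸ hw))
  exact ⟨a, eq_component_of_mem hD hw ▸ ha, hva⟩

/-- A node of the connected set `C` that minimizes the largest component left after its removal
leaves only components of at most half the size of `C`. -/
theorem two_mul_sigma_le (hT : T.IsAcyclic) (hC : IsConn T C) (hv : v ∈ C)
    (hmin : ∀ j ∈ C, sigma T C v ≤ sigma T C j) : 2 * sigma T C v ≤ C.card := by
  by_contra! hlt
  have hne : (components T (insert v Cᶜ)).Nonempty := by
    by_contra hne
    rw [Finset.not_nonempty_iff_eq_empty] at hne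
    simp [sigma, hne] at hlt
  obtain ⟨D, hD, hDs⟩ := Finset.exists_mem_eq_sup _ hne Finset.card
  change sigma T C v = _ at hDs
  rw [hDs] at hlt hmin
  obtain ⟨hDC, hvD⟩ := subset_of_mem_components_insert_compl hD
  -- If the largest part `D` exceeds half of `C`, moving from `v` to its neighbor `a` in `D` is
  -- better: the part containing `v` is disjoint from `D`, hence smaller than `D`, and all other
  -- parts lie in `D` without `a`.
  obtain ⟨a, haD, hva⟩ := hC.exists_adj hv hD
  have haC := hDC haD
  have hpos : 0 < D.card := Finset.card_pos.2 ⟨a, haD⟩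
  refine absurd (hmin a haC) (not_le.2 ((Finset.sup_lt_iff hpos).2 fun E hE => ?_))
  obtain ⟨hEC, haE⟩ := subset_of_mem_components_insert_compl hE
  by_cases hvE : v ∈ E
  · have hdisj : Disjoint E D := by
      refine Finset.disjoint_left.2 fun x hxE hxD => ?_
      rw [eq_component_of_mem hE hvE] at hxE
      rw [eq_component_of_mem hD haD] at hxD
      obtain ⟨b, hab, hb⟩ := exists_adj_mem_component hxD (by
        rintro rfl; exact notMem_of_mem_component hxE (Finset.mem_insert_self _ _))
      have hb1 : b ∈ component T {a} v := mem_component_trans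
        (component_mono (by simp) hxE) (component_mono (by simp) hb)
      obtain rfl := eq_of_adj_of_mem_component hT hva.symm hab hb1
      exact notMem_of_mem_component hb (by simp)
    have := Finset.card_union_of_disjoint hdisj
    have := Finset.card_le_card (Finset.union_subset hEC hDC)
    omega
  · obtain ⟨b, hbE, hab⟩ := hC.exists_adj haC hE
    have hbv : b ≠ v := fun h => hvE (h ▸ hbE)
    have hbD : b ∈ D := by
      rw [eq_component_of_mem hD haD]
      exact mem_component_of_adj hab (disjoint_of_mem_components hD |> Finset.disjoint_left.1 <| haD)
        (by simp [hbv, hEC hbE])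
    have hED : E ⊆ D := by
      rw [eq_component_of_mem hD haD] at hbD ⊢
      refine (isConn_of_mem_components hE).subset_component ?_ hbE hbD
      rw [Finset.disjoint_insert_right, ← le_compl_iff_disjoint_right, compl_compl]
      exact ⟨hvE, hEC⟩
    exact Finset.card_lt_card ⟨hED, fun h => haE (h haD)⟩

/-- Removing from a connected set one of the components left after the removal of a node `v`
leaves a connected set. -/
theorem IsConn.sdiff (hC : IsConn T C) (hv : v ∈ C) (hD : D ∈ components T (insert v Cᶜ)) :
    IsConn T (C \ D) := by
  have hvD := (subset_of_mem_components_insert_compl hD).2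
  have key : ∀ w ∈ C \ D, w ∈ component T (C \ D)ᶜ v := by
    intro w hw
    obtain ⟨hwC, hwD⟩ := Finset.mem_sdiff.1 hw
    have hv' : v ∉ (C \ D)ᶜ := by simp [hv, hvD]
    rcases eq_or_ne w v with rfl | hne
    · exact self_mem_component hv'
    have hw' : w ∉ insert v Cᶜ := by simp [hne, hwC]
    -- `w` lies in another component left by `v`; it is disjoint from `D` and attached to `v` by an
    -- edge.
    have hE := component_mem_components (T := T) hw'
    obtain ⟨a, ha, hva⟩ := hC.exists_adj hv hE
    have hEC := (subset_of_mem_components_insert_compl hE).1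
    have hdisj : Disjoint (component T (insert v Cᶜ) w) (C \ D)ᶜ := by
      refine Finset.disjoint_left.2 fun x hx hx' => ?_
      have hxD : x ∈ D := by
        by_contra hxD
        exact Finset.mem_compl.1 hx' (Finset.mem_sdiff.2 ⟨hEC hx, hxD⟩)
      exact hwD (eq_of_mem_components hE hD hx hxD ▸ self_mem_component hw')
    exact isConn_component.subset_component hdisj ha
      (mem_component_of_adj hva hv' (Finset.disjoint_left.1 hdisj ha)) (self_mem_component hw')
  exact fun w hw x hx => mem_component_trans (mem_component_symm (key w hw)) (key x hx)

/-! ### The forest after one more selection -/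

/-- Selecting `v` affects only its own component, so the potential in `IsSelRun.exists_regions`
changes only through the parts of `C`. -/
theorem components_insert (hC : C ∈ components T S) (hv : v ∈ C) :
    components T (insert v S) = (components T S).erase C ∪ components T (insert v Cᶜ) := by
  have hCS := disjoint_of_mem_components hC
  have hsub : insert v S ⊆ insert v Cᶜ := Finset.insert_subset_insert _ fun x hx =>
    Finset.mem_compl.2 fun hxC => Finset.disjoint_left.1 hCS hxC hx
  have h1 : ∀ w ∈ C, w ≠ v → component T (insert v S) w = component T (insert v Cᶜ) w := by
    intro w hw hwv
    have hwS : w ∉ insert v S := by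
      simpa [hwv] using Finset.disjoint_left.1 hCS hw
    refine Finset.Subset.antisymm ?_ (component_mono hsub)
    refine isConn_component.subset_component ?_ (self_mem_component hwS)
      (self_mem_component (by simp [hwv, hw]))
    rw [Finset.disjoint_insert_right, ← le_compl_iff_disjoint_right, compl_compl]
    refine ⟨fun h => notMem_of_mem_component h (Finset.mem_insert_self _ _), ?_⟩
    rw [eq_component_of_mem hC hw]
    exact component_mono (Finset.subset_insert _ _)
  have h2 : ∀ w ∉ S, w ∉ C → component T (insert v S) w = component T S w := by
    intro w hwS hwC
    refine Finset.Subset.antisymm (component_mono (Finset.subset_insert _ _)) ?_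
    have hvw : v ∉ component T S w := fun h => hwC
      (eq_of_mem_components hC (component_mem_components hwS) hv h ▸ self_mem_component hwS)
    exact isConn_component.subset_component
      (Finset.disjoint_insert_right.2 ⟨hvw, disjoint_component⟩) (self_mem_component hwS)
      (self_mem_component (by simp [hwS, (ne_of_mem_of_not_mem hv hwC).symm]))
  ext D
  rw [Finset.mem_union, Finset.mem_erase]
  constructor
  · intro hD
    obtain ⟨w, hw, rfl⟩ := mem_components.1 hD
    rw [Finset.mem_insert, not_or] at hw
    by_cases hwC : w ∈ C
    · rw [h1 w hwC hw.1]
      exact Or.inr (component_mem_components (by simp [hw.1, hwC]))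
    · rw [h2 w hw.2 hwC]
      exact Or.inl ⟨fun h => hwC (h ▸ self_mem_component hw.2), component_mem_components hw.2⟩
  · rintro (⟨hne, hD⟩ | hD)
    · obtain ⟨w, hw, rfl⟩ := mem_components.1 hD
      have hwC : w ∉ C := fun h => hne (eq_of_mem_components hD hC (self_mem_component hw) h)
      rw [← h2 w hw hwC]
      exact component_mem_components (by simp [hw, (ne_of_mem_of_not_mem hv hwC).symm])
    · obtain ⟨w, hw, rfl⟩ := mem_components.1 hD
      simp only [Finset.mem_insert, Finset.mem_compl, not_or, not_not] at hw
      rw [← h1 w hw.2 hw.1]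
      exact component_mem_components
        (by simpa [hw.1] using Finset.disjoint_left.1 hCS hw.2)

/-! ### The nodes selected by `SEL` -/

theorem IsSelRun.card_firstNodes {i : ℕ → V} (hi : IsSelRun T i) {t : ℕ}
    (ht : t ≤ Fintype.card V) : (firstNodes i t).card = t := by
  induction t with
  | zero => simp [firstNodes]
  | succ t ih =>
    obtain ⟨C, hC, hiC, -⟩ := hi t ht
    rw [firstNodes_succ, Finset.card_insert_of_notMem
      (Finset.disjoint_left.1 (disjoint_of_mem_components hC.1) hiC), ih (by omega)]

/-- A full run selects every node. This settles budgets too large for a comparison at `8 * Q` steps.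
-/
theorem IsSelRun.upsilon_card {i : ℕ → V} (hi : IsSelRun T i) (K : ℕ) :
    upsilon T (plus T (firstNodes i (Fintype.card V))) K = 0 := by
  have h : firstNodes i (Fintype.card V) = Finset.univ :=
    (Finset.card_eq_iff_eq_univ _).1 (hi.card_firstNodes le_rfl)
  refine Nat.le_zero.1 (upsilon_le fun A hA _ => ?_)
  have : components T (plus T (firstNodes i (Fintype.card V))) = ∅ := by
    simp [components, plus, h]
  rw [this, Finset.subset_empty] at hA
  simp [hA]

/-- If `SEL` has made `t` steps and all components had at least `s` nodes when they were split,
then at least `t / 2` disjoint connected regions of size at least `s / 2` exist: the members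
of `F`, and the components that still have at least `s` nodes. -/
theorem IsSelRun.exists_regions (hT : T.IsAcyclic) {i : ℕ → V} (hi : IsSelRun T i) {s t : ℕ}
    (ht : t ≤ Fintype.card V)
    (hs : ∀ u < t, ∀ C, IsLargestComponent T (firstNodes i u) C → s ≤ C.card) :
    ∃ F : Finset (Finset V), (F : Set (Finset V)).PairwiseDisjoint id ∧
      (∀ R ∈ F, IsConn T R ∧ R.Nonempty ∧ s ≤ 2 * R.card ∧
        ∀ D ∈ components T (firstNodes i t), s ≤ D.card → Disjoint R D) ∧
      t ≤ 2 * F.card + ((components T (firstNodes i t)).filter fun D => s ≤ D.card).card := by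
  induction t with
  | zero => exact ⟨∅, by simp⟩
  | succ t ih =>
    obtain ⟨F, hF, hFR, hcard⟩ := ih (by omega) fun u hu => hs u (by omega)
    obtain ⟨C, hCl, hiC, hmin⟩ := hi t ht
    have hsC := hs t (by omega) C hCl
    have hC := hCl.1
    have hconn := isConn_of_mem_components hC
    have hhalf := two_mul_sigma_le hT hconn hiC hmin
    rw [firstNodes_succ, components_insert hC hiC]
    set S := firstNodes i t
    set B := components T (insert (i t) Cᶜ)
    have hBC : ∀ D ∈ B, D ⊆ C := fun D hD => (subset_of_mem_components_insert_compl hD).1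
    have hlive : (((components T S).erase C ∪ B).filter fun D => s ≤ D.card).card + 1 =
        ((components T S).filter fun D => s ≤ D.card).card +
          (B.filter fun D => s ≤ D.card).card := by
      rw [Finset.filter_union, Finset.card_union_of_disjoint, Finset.filter_erase]
      · have hm : C ∈ (components T S).filter fun D => s ≤ D.card :=
          Finset.mem_filter.2 ⟨hC, hsC⟩
        have := Finset.card_erase_add_one hm
        omega
      · refine Finset.disjoint_filter_filter (Finset.disjoint_left.2 fun D hD hDB => ?_)
        obtain ⟨hne, hD⟩ := Finset.mem_erase.1 hD
        obtain ⟨x, hx⟩ := nonempty_of_mem_components hDB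
        exact hne (eq_of_mem_components hD hC hx (hBC D hDB hx))
    have hnew : ∀ R ⊆ C, R.Nonempty → IsConn T R → s ≤ 2 * R.card →
        (∀ D ∈ B, s ≤ D.card → Disjoint R D) →
        ∃ F : Finset (Finset V), (F : Set (Finset V)).PairwiseDisjoint id ∧
          (∀ R ∈ F, IsConn T R ∧ R.Nonempty ∧ s ≤ 2 * R.card ∧
            ∀ D ∈ (components T S).erase C ∪ B, s ≤ D.card → Disjoint R D) ∧
          t + 1 ≤ 2 * F.card +
            (((components T S).erase C ∪ B).filter fun D => s ≤ D.card).card := by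
      intro R hRC hRne hRconn hRs hRB
      have hdis : ∀ R' ∈ F, Disjoint R R' := fun R' hR' =>
        (((hFR R' hR').2.2.2 C hC hsC).mono_right hRC).symm
      have hRF : R ∉ F := fun h => by
        obtain ⟨x, hx⟩ := hRne
        exact Finset.disjoint_left.1 (hdis R h) hx hx
      refine ⟨insert R F, ?_, ?_, ?_⟩
      · rw [Finset.coe_insert]
        exact hF.insert fun R' hR' _ => hdis R' hR'
      · intro R' hR'
        rcases Finset.mem_insert.1 hR' with rfl | hR'
        · refine ⟨hRconn, hRne, hRs, fun D hD hDs => ?_⟩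
          rcases Finset.mem_union.1 hD with hD | hD
          · obtain ⟨hne, hD⟩ := Finset.mem_erase.1 hD
            exact (pairwiseDisjoint_components hC hD hne.symm).mono_left hRC
          · exact hRB D hD hDs
        · obtain ⟨h1, h2, h3, h4⟩ := hFR R' hR'
          refine ⟨h1, h2, h3, fun D hD hDs => ?_⟩
          rcases Finset.mem_union.1 hD with hD | hD
          · exact h4 D (Finset.mem_of_mem_erase hD) hDs
          · exact (h4 C hC hsC).mono_right (hBC D hD)
      · rw [Finset.card_insert_of_notMem hRF]
        omega
    have hcases : (B.filter fun D => s ≤ D.card).card = 0 ∨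
        (B.filter fun D => s ≤ D.card).card = 1 ∨ 2 ≤ (B.filter fun D => s ≤ D.card).card := by
      omega
    -- The potential, twice the number of regions plus the number of large components, grows by at
    -- least one. With no large part, `C` becomes a region (+2 − 1). With one large part `E`, the
    -- rest `C \ E` becomes a region (+2), of size at least half of `C` by the centroid property.
    -- With two or more, the number of large components itself grows.
    rcases hcases with h0 | h1 | h2
    · rw [Finset.card_eq_zero, Finset.filter_eq_empty_iff] at h0
      exact hnew C subset_rfl ⟨_, hiC⟩ hconn (by omega) fun D hD hDs => absurd hDs (h0 hD)
    · obtain ⟨E, hE⟩ := Finset.card_eq_one.1 h1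
      have hE' : E ∈ B ∧ s ≤ E.card :=
        Finset.mem_filter.1 (hE ▸ Finset.mem_singleton_self E)
      have hEs : E.card ≤ sigma T C (i t) := Finset.le_sup hE'.1
      have hiE := (subset_of_mem_components_insert_compl hE'.1).2
      have hdiff := Finset.card_sdiff_add_card_eq_card (hBC E hE'.1)
      refine hnew (C \ E) Finset.sdiff_subset ⟨_, Finset.mem_sdiff.2 ⟨hiC, hiE⟩⟩
        (hconn.sdiff hiC hE'.1) (by omega) fun D hD hDs => ?_
      have : D ∈ B.filter fun D => s ≤ D.card := Finset.mem_filter.2 ⟨hD, hDs⟩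
      rw [hE, Finset.mem_singleton] at this
      rw [this]
      exact Finset.sdiff_disjoint
    · refine ⟨F, hF, fun R hR => ?_, by omega⟩
      obtain ⟨h1, h2, h3, h4⟩ := hFR R hR
      refine ⟨h1, h2, h3, fun D hD hDs => ?_⟩
      rcases Finset.mem_union.1 hD with hD | hD
      · exact h4 D (Finset.mem_of_mem_erase hD) hDs
      · exact (h4 C hC hsC).mono_right (hBC D hD)

/-- After `4 * |M|` steps, `SEL` is as good as `M`, up to a factor of three. -/
theorem IsSelRun.upsilon_le (hT : T.IsAcyclic) {i : ℕ → V} (hi : IsSelRun T i) {t : ℕ}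
    (ht : t ≤ Fintype.card V) (hM : 4 * M.card ≤ t) (K : ℕ) :
    upsilon T (firstNodes i t) K ≤ 3 * upsilon T M K := by
  set s := (components T (firstNodes i t)).sup Finset.card with hs
  have hle : ∀ C ∈ components T (firstNodes i t), C.card ≤ s := fun C hC => Finset.le_sup hC
  -- Every final component lies in a component of each earlier forest, so all components that were
  -- split had at least `s` nodes.
  obtain ⟨F, hF, hFR, hcard⟩ := hi.exists_regions hT (s := s) ht fun u hu C hC => by
    refine Finset.sup_le fun D hD => ?_
    obtain ⟨E, hE, hDE⟩ := (isConn_of_mem_components hD).exists_mem_components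
      (nonempty_of_mem_components hD)
      ((disjoint_of_mem_components hD).mono_right (firstNodes_mono i hu.le))
    exact (Finset.card_le_card hDE).trans (hC.2 E hE)
  set B := (components T (firstNodes i t)).filter fun D => s ≤ D.card
  have hBm : ∀ D ∈ B, D ∈ components T (firstNodes i t) ∧ s ≤ D.card := fun D hD =>
    Finset.mem_filter.1 hD
  have hFB : Disjoint F B := Finset.disjoint_left.2 fun R hR hRB => by
    obtain ⟨-, ⟨x, hx⟩, -, h⟩ := hFR R hR
    exact Finset.disjoint_left.1 (h R (hBm R hRB).1 (hBm R hRB).2) hx hx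
  have hG : ((F ∪ B : Finset (Finset V)) : Set (Finset V)).PairwiseDisjoint id := by
    rw [Finset.coe_union, Set.pairwiseDisjoint_union]
    refine ⟨hF, pairwiseDisjoint_components.subset fun D hD => (hBm D hD).1, ?_⟩
    exact fun R hR D hD _ => (hFR R hR).2.2.2 D (hBm D hD).1 (hBm D hD).2
  have hGR : ∀ R ∈ F ∪ B, IsConn T R ∧ R.Nonempty ∧ s ≤ 2 * R.card := by
    intro R hR
    rcases Finset.mem_union.1 hR with hR | hR
    · exact ⟨(hFR R hR).1, (hFR R hR).2.1, (hFR R hR).2.2.1⟩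
    · have := hBm R hR
      exact ⟨isConn_of_mem_components this.1, nonempty_of_mem_components this.1, by omega⟩
  have hGcard := Finset.card_union_of_disjoint hFB
  generalize F ∪ B = G at hG hGR hGcard
  have hhit := card_filter_not_disjoint_le hG M
  have hsplit := Finset.card_filter_add_card_filter_not (s := G) (fun R => Disjoint R M)
  refine ActiveTree.upsilon_le fun A hA hK => ?_
  have hAd := pairwiseDisjoint_components.subset hA
  have hAhit := card_filter_not_disjoint_le hAd M
  rw [← Finset.sum_filter_add_sum_filter_not A (fun R => Disjoint R M)]
  have h1 : ∑ R ∈ A.filter (fun R => Disjoint R M), R.card ≤ upsilon T M K :=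
    sum_card_le_upsilon (hAd.subset (Finset.filter_subset _ _))
      ((Finset.card_filter_le _ _).trans hK) fun R hR => by
        obtain ⟨hR, hRM⟩ := Finset.mem_filter.1 hR
        exact ⟨isConn_of_mem_components (hA hR), nonempty_of_mem_components (hA hR), hRM⟩
  have h2 : ∑ R ∈ A.filter (fun R => ¬ Disjoint R M), R.card ≤
      (A.filter fun R => ¬ Disjoint R M).card * s := by
    rw [← smul_eq_mul]
    exact Finset.sum_le_card_nsmul _ _ _ fun R hR => hle R (hA (Finset.filter_subset _ _ hR))
  -- `4 * M.card ≤ t ≤ 2 * G.card` leaves at least `M.card` regions that avoid `M`, enough to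
  -- replace each member of `A` that meets `M`; sizes at most `s` are traded for sizes at least `s /
  -- 2`.
  obtain ⟨G', hG', hG'card⟩ := Finset.exists_subset_card_eq
    (show (A.filter fun R => ¬ Disjoint R M).card ≤ (G.filter fun R => Disjoint R M).card by
      omega)
  have h3 : ∑ R ∈ G', R.card ≤ upsilon T M K :=
    sum_card_le_upsilon (hG.subset (hG'.trans (Finset.filter_subset _ _)))
      (hG'card.trans_le ((Finset.card_filter_le _ _).trans hK)) fun R hR => by
        obtain ⟨hR, hRM⟩ := Finset.mem_filter.1 (hG' hR)
        exact ⟨(hGR R hR).1, (hGR R hR).2.1, hRM⟩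
  have h4 : G'.card * s ≤ ∑ R ∈ G', 2 * R.card := by
    rw [← smul_eq_mul]
    exact Finset.card_nsmul_le_sum _ _ _ fun R hR =>
      (hGR R (Finset.filter_subset _ _ (hG' hR))).2.2
  rw [← Finset.mul_sum, hG'card] at h4
  omega

end

/-! ### Bounding the cutsize by a set of edges -/

section
variable {V : Type*} {T : SimpleGraph V}

theorem cutsize_le {y : V → Bool} {F : Finset (Sym2 V)}
    (h : ∀ a b, T.Adj a b → y a ≠ y b → s(a, b) ∈ F) : cutsize T y ≤ F.card := by
  rw [cutsize, ← Set.ncard_coe_finset]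
  refine Set.ncard_le_ncard ?_ F.finite_toSet
  rintro _ ⟨he, a, b, rfl, hab⟩
  exact h a b he hab

end

section
variable {V : Type*} [Fintype V] {T : SimpleGraph V} {S S' C D L M A : Finset V}
  {u v w f a b : V}
open scoped Classical

/-! ### The boundary of a component -/

/-- The edges of `T` that leave `C`. -/
noncomputable def boundary (T : SimpleGraph V) (C : Finset V) : Finset (Sym2 V) :=
  ((Finset.univ : Finset (V × V)).filter fun e => T.Adj e.1 e.2 ∧ e.1 ∈ C ∧ e.2 ∉ C).image
    fun e => s(e.1, e.2)

theorem mem_boundary {e : Sym2 V} :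
    e ∈ boundary T C ↔ ∃ a ∈ C, ∃ u, u ∉ C ∧ T.Adj a u ∧ e = s(a, u) := by
  simp only [boundary, Finset.mem_image, Finset.mem_filter, Finset.mem_univ, true_and,
    Prod.exists]
  constructor
  · rintro ⟨a, u, ⟨h, ha, hu⟩, rfl⟩
    exact ⟨a, ha, u, hu, h, rfl⟩
  · rintro ⟨a, ha, u, hu, h, rfl⟩
    exact ⟨a, u, ⟨h, ha, hu⟩, rfl⟩

theorem mem_of_adj_component (hC : C ∈ components T M) (ha : a ∈ C) (h : T.Adj a u)
    (hu : u ∉ C) : u ∈ M := by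
  by_contra huM
  rw [eq_component_of_mem hC ha] at hu
  exact hu (mem_component_of_adj h (Finset.disjoint_left.1 (disjoint_of_mem_components hC) ha) huM)

/-- The neighbor of `f` in the direction of `u` is closer to `u`. -/
theorem exists_adj_dist (hT : T.Connected) (h : u ≠ f) :
    ∃ g, T.Adj f g ∧ g ∈ component T {f} u ∧ T.dist g u + 1 = T.dist f u := by
  obtain ⟨p, hp, hlen⟩ := hT.exists_path_of_dist f u
  cases p with
  | nil => exact absurd rfl h
  | cons hfg q =>
    rename_i g
    rw [SimpleGraph.Walk.cons_isPath_iff] at hp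
    refine ⟨g, hfg, mem_component_symm (mem_component.2 ⟨q, fun x hx hxf => hp.2 ?_⟩), ?_⟩
    · rw [Finset.mem_singleton] at hxf
      exact hxf ▸ hx
    · have h1 := SimpleGraph.dist_le q
      have h2 : T.dist f u ≤ T.dist f g + T.dist g u := hT.dist_triangle
      rw [SimpleGraph.dist_eq_one_iff_adj.2 hfg] at h2
      rw [SimpleGraph.Walk.length_cons] at hlen
      omega

/-- If two connection nodes of a component `C` lie on the same side of `f ∈ C`, then a neighbor
of `f` in `C` is closer to both of them. -/
theorem exists_mem_closer (hT : T.IsTree) (hC : C ∈ components T M) (hf : f ∈ C)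
    (hu : u ∈ M) (hv : v ∈ M) (hne : u ≠ v) (hua : ∃ a ∈ C, T.Adj a u) (hvb : ∃ b ∈ C, T.Adj b v)
    (h : component T {f} u = component T {f} v) :
    ∃ g ∈ C, T.Adj f g ∧ T.dist g u + 1 = T.dist f u ∧ T.dist g v + 1 = T.dist f v := by
  have hCM := disjoint_of_mem_components hC
  have hfM := Finset.disjoint_left.1 hCM hf
  obtain ⟨g, hfg, hg, hgd⟩ := exists_adj_dist hT.connected (ne_of_mem_of_not_mem hu hfM)
  obtain ⟨g', hfg', hg', hgd'⟩ := exists_adj_dist hT.connected (ne_of_mem_of_not_mem hv hfM)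
  obtain rfl : g = g' := eq_of_adj_of_mem_component hT.isAcyclic hfg hfg'
    (mem_component_trans (mem_component_symm hg) (h ▸ hg'))
  refine ⟨g, ?_, hfg, hgd, hgd'⟩
  by_contra hgC
  have hgM := mem_of_adj_component hC hf hfg hgC
  -- If `g` is outside `C`, then `C` can be traversed without `g`, so a different connection node is
  -- reached from `f` through another neighbor and is not on the side of `g`. Both `u` and `v` would
  -- then equal `g`.
  have key : ∀ w ∈ M, (∃ a ∈ C, T.Adj a w) → g ∈ component T {f} w → w = g := by
    rintro w hw ⟨a, haC, haw⟩ hgw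
    by_contra hwg
    have hfg1 : f ∉ ({g} : Finset V) := by simpa using hfg.ne
    have hCg : C ⊆ component T {g} f := (isConn_of_mem_components hC).subset_component
      (by simpa using hgC) hf (self_mem_component hfg1)
    have hwf := mem_component_adj (hCg haC) haw (by simpa using hwg)
    have hwf' := ne_of_mem_of_not_mem hw hfM
    obtain ⟨b, hfb, hb⟩ := exists_adj_mem_component hwf hwf'
    have hb1 : b ∈ component T {f} w := component_mono (by simp) hb
    obtain rfl := eq_of_adj_of_mem_component hT.isAcyclic hfg hfb
      (mem_component_trans (mem_component_symm hgw) hb1)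
    exact notMem_of_mem_component hb (by simp)
  exact hne ((key u hu hua hg).trans (key v hv hvb hg').symm)

/-- Three connection nodes of a component generate a fork node in it. -/
theorem exists_mem_fork (hT : T.IsTree) (hC : C ∈ components T M) {u : Fin 3 → V}
    (hinj : Function.Injective u) (hu : ∀ k, u k ∈ M ∧ ∃ a ∈ C, T.Adj a (u k)) :
    ∃ f ∈ C, f ∈ fork T M := by
  -- `f` is the median of the three nodes. If two were on one side of it, a step towards both would
  -- gain 2 and lose at most 1.
  obtain ⟨f, hf, hmin⟩ := Finset.exists_min_image C (fun f => ∑ k, T.dist f (u k))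
    (nonempty_of_mem_components hC)
  refine ⟨f, hf, (mem_fork hT).2
    ⟨Finset.disjoint_left.1 (disjoint_of_mem_components hC) hf, Finset.two_lt_card.2 ?_⟩⟩
  have key : ∀ k l, k ≠ l → component T {f} (u k) ≠ component T {f} (u l) := by
    intro k l hkl h
    obtain ⟨g, hg, hfg, hk, hl⟩ := exists_mem_closer hT hC hf (hu k).1 (hu l).1
      (hinj.ne hkl) (hu k).2 (hu l).2 h
    have hlip : ∀ m, T.dist g (u m) ≤ T.dist f (u m) + 1 := fun m => by
      have h1 : T.dist g (u m) ≤ T.dist g f + T.dist f (u m) := hT.connected.dist_triangle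
      rw [SimpleGraph.dist_eq_one_iff_adj.2 hfg.symm] at h1
      omega
    have h3 := hmin g hg
    simp only [Fin.sum_univ_three] at h3
    have h0 := hlip 0
    have h1 := hlip 1
    have h2 := hlip 2
    fin_cases k <;> fin_cases l <;> simp at hkl hk hl <;> omega
  have hm : ∀ k, component T {f} (u k) ∈ M.image (component T {f}) := fun k =>
    Finset.mem_image_of_mem _ (hu k).1
  exact ⟨_, hm 0, _, hm 1, _, hm 2, key 0 1 (by decide), key 0 2 (by decide),
    key 1 2 (by decide)⟩

/-- Distinct boundary edges have distinct outer ends, as `T` has no cycle. Three of them would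
generate a fork node inside `C`. -/
theorem card_boundary_le (hT : T.IsTree) (hM : IsZeroForked T M) (hC : C ∈ components T M) :
    (boundary T C).card ≤ 2 := by
  by_contra! hcard
  have hCM := disjoint_of_mem_components hC
  obtain ⟨_, h1, _, h2, _, h3, h12, h13, h23⟩ := Finset.two_lt_card.1 hcard
  obtain ⟨a₁, ha₁, u₁, hu₁, e1, rfl⟩ := mem_boundary.1 h1
  obtain ⟨a₂, ha₂, u₂, hu₂, e2, rfl⟩ := mem_boundary.1 h2
  obtain ⟨a₃, ha₃, u₃, hu₃, e3, rfl⟩ := mem_boundary.1 h3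
  have key : ∀ {a a' u u' : V}, a ∈ C → a' ∈ C → u ∉ C → T.Adj a u → T.Adj a' u' →
      s(a, u) ≠ s(a', u') → u ≠ u' := by
    rintro a a' u u' ha ha' hu h h' hne rfl
    have hau : a ∉ ({u} : Finset V) := by simpa using h.ne
    have := (isConn_of_mem_components hC).subset_component (S := {u}) (by simpa using hu) ha
      (self_mem_component hau) ha'
    exact hne (eq_of_adj_of_mem_component hT.isAcyclic h.symm h'.symm this ▸ rfl)
  have k12 := key ha₁ ha₂ hu₁ e1 e2 h12
  have k13 := key ha₁ ha₃ hu₁ e1 e3 h13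
  have k23 := key ha₂ ha₃ hu₂ e2 e3 h23
  obtain ⟨f, hf, hfork⟩ := exists_mem_fork hT hC (u := ![u₁, u₂, u₃])
    (by
      intro k l hkl
      fin_cases k <;> fin_cases l <;> simp_all [eq_comm])
    (by
      intro k
      fin_cases k
      exacts [⟨mem_of_adj_component hC ha₁ e1 hu₁, a₁, ha₁, e1⟩,
        ⟨mem_of_adj_component hC ha₂ e2 hu₂, a₂, ha₂, e2⟩,
        ⟨mem_of_adj_component hC ha₃ e3 hu₃, a₃, ha₃, e3⟩])
  refine Finset.disjoint_left.1 hCM hf ?_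
  rw [← hM]
  exact Finset.mem_union_right _ hfork

/-! ### Labelings with a given cut -/

/-- Every edge of a forest is a bridge: flipping the labels on one side of it changes the status of
this edge alone. -/
theorem exists_labeling_of_cut (hT : T.IsAcyclic) (F : Finset (Sym2 V)) :
    ∃ y : V → Bool, ∀ a b, T.Adj a b → (y a ≠ y b ↔ s(a, b) ∈ F) := by
  induction F using Finset.induction with
  | empty => exact ⟨fun _ => true, by simp⟩
  | insert e F he ih =>
    obtain ⟨y, hy⟩ := ih
    by_cases heT : e ∈ T.edgeSet
    · induction e with
      | _ c d =>
        have hb := SimpleGraph.isAcyclic_iff_forall_isBridge.1 hT heT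
        rw [SimpleGraph.isBridge_iff] at hb
        obtain ⟨G, hG⟩ : ∃ G, G = T.deleteEdges {s(c, d)} := ⟨_, rfl⟩
        rw [← hG] at hb
        have hcut : ∀ a b, T.Adj a b →
            (decide (G.Reachable c a) ≠ decide (G.Reachable c b) ↔ s(a, b) = s(c, d)) := by
          intro a b hab
          rw [Ne, decide_eq_decide]
          constructor
          · intro h
            by_contra hne
            have hGab : G.Adj a b := by
              rw [hG, SimpleGraph.deleteEdges_adj]
              exact ⟨hab, hne⟩
            exact h ⟨fun h => h.trans hGab.reachable, fun h => h.trans hGab.symm.reachable⟩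
          · intro h
            rw [Sym2.eq_iff] at h
            rcases h with ⟨rfl, rfl⟩ | ⟨rfl, rfl⟩
            · simpa using hb
            · simpa using fun h : G.Reachable b a => hb h
        refine ⟨fun v => xor (y v) (decide (G.Reachable c v)), fun a b hab => ?_⟩
        have h1 := hy a b hab
        have h2 := hcut a b hab
        rw [Finset.mem_insert, ← h1, ← h2]
        dsimp only
        have h3 : ¬ (y a ≠ y b ∧ decide (G.Reachable c a) ≠ decide (G.Reachable c b)) := by
          rw [h1, h2]
          rintro ⟨h, h'⟩
          exact he (h' ▸ h)
        revert h3
        generalize y a = p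
        generalize y b = q
        generalize decide (G.Reachable c a) = r
        generalize decide (G.Reachable c b) = t
        revert p q r t
        decide
    · refine ⟨y, fun a b hab => ?_⟩
      rw [hy a b hab, Finset.mem_insert, or_iff_right]
      rintro rfl
      exact heT hab

/-- Two labelings of cutsize at most `K` that differ exactly on the given components. -/
theorem exists_labelings (hT : T.IsTree) (hM : IsZeroForked T M) {K : ℕ} {A : Finset (Finset V)}
    (hA : A ⊆ components T M) (hK : A.card ≤ K) :
    ∃ y z : V → Bool, cutsize T y ≤ K ∧ cutsize T z ≤ K ∧
      ∀ v, y v ≠ z v ↔ ∃ C ∈ A, v ∈ C := by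
  -- At most two boundary edges are divided between the two labelings, one each; this keeps both
  -- cutsizes within `A.card`.
  have hsplit : ∀ C ∈ A, ∃ f ⊆ boundary T C, f.card ≤ 1 ∧ (boundary T C \ f).card ≤ 1 := by
    intro C hC
    have h2 := card_boundary_le hT hM (hA hC)
    obtain ⟨f, hf, hcard⟩ := Finset.exists_subset_card_eq
      (show min 1 (boundary T C).card ≤ (boundary T C).card from min_le_right _ _)
    refine ⟨f, hf, by omega, ?_⟩
    rw [Finset.card_sdiff_of_subset hf]
    omega
  choose! f hf hf1 hf2 using hsplit
  obtain ⟨y, hy⟩ := exists_labeling_of_cut hT.isAcyclic (A.biUnion f)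
  have hout : ∀ C ∈ A, ∀ D ∈ A, ∀ a ∈ C, ∀ b ∈ D, b ∉ C → ¬ T.Adj a b := by
    intro C hC D hD a ha b hb hbC hab
    exact Finset.disjoint_left.1 (disjoint_of_mem_components (hA hD)) hb
      (mem_of_adj_component (hA hC) ha hab hbC)
  have hbd : ∀ C ∈ A, ∀ a b, T.Adj a b → s(a, b) ∈ boundary T C →
      ((∃ D ∈ A, a ∈ D) ↔ ¬ ∃ D ∈ A, b ∈ D) := by
    intro C hC a b hab h
    obtain ⟨c, hc, u, hu, hcu, he⟩ := mem_boundary.1 h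
    have hu' : ¬ ∃ D ∈ A, u ∈ D := fun ⟨D, hD, huD⟩ => hout C hC D hD c hc u huD hu hcu
    have hc' : ∃ D ∈ A, c ∈ D := ⟨C, hC, hc⟩
    rw [Sym2.eq_iff] at he
    rcases he with ⟨rfl, rfl⟩ | ⟨rfl, rfl⟩
    · exact ⟨fun _ => hu', fun _ => hc'⟩
    · exact ⟨fun h => absurd h hu', fun h => absurd hc' h⟩
  have hcross : ∀ a b, T.Adj a b → y a = y b → (∃ C ∈ A, a ∈ C) → (¬ ∃ C ∈ A, b ∈ C) →
      s(a, b) ∈ A.biUnion fun C => boundary T C \ f C := by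
    rintro a b hab hyab ⟨C, hC, ha⟩ hb
    refine Finset.mem_biUnion.2 ⟨C, hC, Finset.mem_sdiff.2 ⟨mem_boundary.2
      ⟨a, ha, b, fun h => hb ⟨C, hC, h⟩, hab, rfl⟩, fun h => ?_⟩⟩
    exact (hy a b hab).2 (Finset.mem_biUnion.2 ⟨C, hC, h⟩) hyab
  -- Flipping `y` on the components of `A` toggles exactly their boundary edges, so `f C` is
  -- exchanged for its complement in the boundary.
  refine ⟨y, fun v => xor (y v) (decide (∃ C ∈ A, v ∈ C)), ?_, ?_, ?_⟩
  · refine (cutsize_le fun a b hab h => (hy a b hab).1 h).trans ?_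
    refine (Finset.card_biUnion_le_card_mul _ _ 1 hf1).trans (by omega)
  · refine (cutsize_le (F := A.biUnion fun C => boundary T C \ f C) fun a b hab h => ?_).trans
      ((Finset.card_biUnion_le_card_mul _ _ 1 hf2).trans (by omega))
    by_cases hyab : y a = y b
    · have hU : ¬ ((∃ C ∈ A, a ∈ C) ↔ ∃ C ∈ A, b ∈ C) := fun hU => h (by simp only [hyab, hU])
      by_cases ha : ∃ C ∈ A, a ∈ C
      · exact hcross a b hab hyab ha fun hb => hU ⟨fun _ => hb, fun _ => ha⟩
      · rw [Sym2.eq_swap]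
        refine hcross b a hab.symm hyab.symm (by_contra fun hb => hU ?_) ha
        exact ⟨fun h => absurd h ha, fun h => absurd h hb⟩
    · exfalso
      obtain ⟨C, hC, he⟩ := Finset.mem_biUnion.1 ((hy a b hab).1 hyab)
      have hiff := hbd C hC a b hab (hf C hC he)
      refine h ?_
      rw [decide_eq_decide.2 hiff, decide_not]
      revert hyab
      generalize y a = p
      generalize y b = q
      generalize decide (∃ C ∈ A, b ∈ C) = r
      revert p q r
      decide
  · intro v
    by_cases hv : ∃ C ∈ A, v ∈ C
    · simp only [hv, decide_true, Bool.xor_true, iff_true]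
      cases y v <;> decide
    · simp [hv]

/-! ### Bounds on the number of mistakes -/

theorem sum_toReal_pmf {α : Type*} [Fintype α] (p : PMF α) : ∑ z, (p z).toReal = 1 := by
  have h : ∑ z, p z = 1 := by rw [← p.tsum_coe, tsum_fintype]
  rw [← ENNReal.toReal_sum fun z _ => p.apply_ne_top z, h, ENNReal.toReal_one]

theorem mistakes_le_worstMistakes {K : ℕ} (P : Predictor V) (L : Finset V) {y : V → Bool}
    (hy : cutsize T y ≤ K) : mistakes P L y ≤ worstMistakes T P L K :=
  le_ciSup (f := fun y : {y : V → Bool // cutsize T y ≤ K} => mistakes P L y.1)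
    (Set.finite_range _).bddAbove ⟨y, hy⟩

/-- Every prediction algorithm makes at least `upsilon T (plus T L) K / 2` mistakes. -/
theorem upsilon_le_two_mul_worstMistakes (hT : T.IsTree) (P : Predictor V) (L : Finset V)
    (K : ℕ) : (upsilon T (plus T L) K : ℝ) ≤ 2 * worstMistakes T P L K := by
  obtain ⟨A, hA, hK, hsum⟩ := exists_upsilon_eq T (plus T L) K
  obtain ⟨y, z, hy, hz, hyz⟩ := exists_labelings hT (isZeroForked_plus hT) hA hK
  have hL : ∀ v ∈ L, y v = z v := fun v hv => by
    by_contra h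
    obtain ⟨C, hC, hvC⟩ := (hyz v).1 h
    exact Finset.disjoint_left.1 (disjoint_of_mem_components (hA hC)) hvC
      (Finset.mem_union_left _ hv)
  -- `P` receives the same input for both labelings, hence draws from the same distribution.
  have hlab : (fun v : L => y v) = fun v : L => z v := funext fun v => hL v v.2
  have hmis : ∀ x : V → Bool,
      upsilon T (plus T L) K ≤ numMistakes L y x + numMistakes L z x := by
    intro x
    have hb := Finset.card_biUnion (s := A) (t := id)
      (fun C hC D hD h => pairwiseDisjoint_components (hA hC) (hA hD) h)
    simp only [id] at hb
    rw [← hsum, ← hb, numMistakes, numMistakes]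
    refine (Finset.card_le_card fun v hv => ?_).trans (Finset.card_union_le _ _)
    obtain ⟨C, hC, hvC⟩ := Finset.mem_biUnion.1 hv
    have hne := (hyz v).2 ⟨C, hC, hvC⟩
    have hvL : v ∉ L := fun h => hne (hL v h)
    simp only [Finset.mem_union, Finset.mem_filter, Finset.mem_univ, true_and, hvL,
      not_false_eq_true]
    by_contra! h
    exact hne (h.1.symm.trans h.2)
  have key : (upsilon T (plus T L) K : ℝ) ≤ mistakes P L y + mistakes P L z := by
    rw [mistakes, mistakes, hlab, ← Finset.sum_add_distrib]
    calc (upsilon T (plus T L) K : ℝ)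
        = ∑ x, (P L (fun v : L => z v) x).toReal * upsilon T (plus T L) K := by
          rw [← Finset.sum_mul, sum_toReal_pmf, one_mul]
      _ ≤ _ := Finset.sum_le_sum fun x _ => by
          rw [← mul_add]
          exact mul_le_mul_of_nonneg_left (by exact_mod_cast hmis x) ENNReal.toReal_nonneg
  have h1 := mistakes_le_worstMistakes P L hy
  have h2 := mistakes_le_worstMistakes P L hz
  linarith

theorem worstMistakes_nonneg (P : Predictor V) (L : Finset V) (K : ℕ) :
    0 ≤ worstMistakes T P L K :=
  Real.iSup_nonneg fun _ => Finset.sum_nonneg fun _ _ => by positivity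

/-- `PRED` makes mistakes only in components that an edge of the cut touches. -/
theorem numMistakes_le_upsilon {K : ℕ} {P : Predictor V} (hP : IsPred T P) (hne : L.Nonempty)
    (hL : IsZeroForked T L) {y z : V → Bool} (hy : cutsize T y ≤ K)
    (hz : z ∈ (P L fun v => y v).support) : numMistakes L y z ≤ upsilon T L K := by
  have : Nonempty V := ⟨hne.choose⟩
  have : Nonempty (Sym2 V) := ⟨s(hne.choose, hne.choose)⟩
  set A := (components T L).filter fun C => ∃ v ∈ C, z v ≠ y v
  have hAC : ∀ C ∈ A, C ∈ components T L := fun C hC => (Finset.mem_filter.1 hC).1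
  have hcut : ∀ C ∈ A, ∃ e : Sym2 V, ∃ a ∈ C, ∃ b, (b ∈ C ∨ b ∈ L) ∧ T.Adj a b ∧ y a ≠ y b ∧
      e = s(a, b) := by
    intro C hC
    obtain ⟨hC, v, hv, hzv⟩ := Finset.mem_filter.1 hC
    by_contra! hno
    -- With no cut edge touching `C`, its nodes and its connection nodes share one label, which both
    -- readings of `PRED` predict.
    have hmono : ∀ w ∈ C, y w = y v := by
      intro w hw
      rw [eq_component_of_mem hC hv] at hw
      obtain ⟨p, hp⟩ := mem_component.1 (mem_component_symm hw)
      have : ∀ (a b : V) (p : T.Walk a b), (∀ x ∈ p.support, x ∈ C) → y a = y b := by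
        intro a b p
        induction p with
        | nil => exact fun _ => rfl
        | cons h p ih =>
          intro hp
          refine Eq.trans ?_ (ih fun x hx => hp x (by simp [hx]))
          by_contra hne
          exact hno _ _ (hp _ (by simp)) _ (Or.inl (hp _ (by simp))) h hne rfl
      refine this w v p fun x hx => ?_
      rw [eq_component_of_mem hC hv]
      exact mem_component_trans hw (support_subset_component p hp hx)
    have hconn : ∀ u : L, IsConnectionNode T L C u → y u = y v := by
      rintro u ⟨-, a, ha, hua⟩
      rw [← hmono a ha]
      by_contra hne
      exact hno _ a ha u (Or.inr u.2) hua.symm (Ne.symm hne) rfl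
    rcases hP L _ hne hL z hz C hC with ⟨u, hu, h⟩ | h
    · exact hzv ((h v hv).trans (hconn u hu))
    · obtain ⟨u, hu, -, h⟩ := h v hv
      exact hzv (h.trans (hconn u hu))
  choose! e a ha b hb hab hyab he using hcut
  -- A cut edge is charged by one component only: its other end lies in the same component or in
  -- `L`.
  have hcard : A.card ≤ K := by
    refine le_trans ?_ hy
    rw [cutsize, ← Set.ncard_coe_finset]
    refine Set.ncard_le_ncard_of_injOn e (fun C hC => ?_) (fun C hC D hD hCD => ?_)
      (Set.toFinite _)
    · exact ⟨he C hC ▸ hab C hC, a C, b C, he C hC, hyab C hC⟩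
    · have hmem : a C ∈ s(a D, b D) := by
        rw [← he D hD, ← hCD, he C hC]
        exact Sym2.mem_mk_left _ _
      have haL := Finset.disjoint_left.1 (disjoint_of_mem_components (hAC C hC)) (ha C hC)
      refine eq_of_mem_components (hAC C hC) (hAC D hD) (ha C hC) ?_
      rcases Sym2.mem_iff.1 hmem with h | h
      · exact h ▸ ha D hD
      · exact h ▸ (hb D hD).resolve_right (h ▸ haL)
  have hdisj : (A : Set (Finset V)).PairwiseDisjoint id := pairwiseDisjoint_components.subset hAC
  refine le_trans ?_ (sum_card_le_upsilon hdisj hcard fun C hC =>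
    ⟨isConn_of_mem_components (hAC C hC), nonempty_of_mem_components (hAC C hC),
      disjoint_of_mem_components (hAC C hC)⟩)
  refine (Finset.card_le_card fun v hv => ?_).trans Finset.card_biUnion_le
  simp only [Finset.mem_filter, Finset.mem_univ, true_and] at hv
  exact Finset.mem_biUnion.2 ⟨_, Finset.mem_filter.2 ⟨component_mem_components hv.1, v,
    self_mem_component hv.1, hv.2⟩, self_mem_component hv.1⟩

theorem worstMistakes_le_upsilon {P : Predictor V} (hP : IsPred T P) (hne : L.Nonempty)
    (hL : IsZeroForked T L) (K : ℕ) : worstMistakes T P L K ≤ upsilon T L K := by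
  refine Real.iSup_le (fun ⟨y, hy⟩ => ?_) (Nat.cast_nonneg _)
  calc mistakes P L y
      ≤ ∑ z, (P L (fun v : L => y v) z).toReal * upsilon T L K := by
        refine Finset.sum_le_sum fun z _ => ?_
        by_cases hz : z ∈ (P L fun v => y v).support
        · exact mul_le_mul_of_nonneg_left
            (by exact_mod_cast numMistakes_le_upsilon hP hne hL hy hz) ENNReal.toReal_nonneg
        · have hz0 : P L (fun v : L => y v) z = 0 := by
            simpa [PMF.mem_support_iff] using hz
          simp [hz0]
    _ = upsilon T L K := by rw [← Finset.sum_mul, sum_toReal_pmf, one_mul]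

/-! ### Queries plus mistakes -/

theorem plus_nonempty (h : L.Nonempty) : (plus T L).Nonempty :=
  h.mono Finset.subset_union_left

/-- The minimizer is compared with `8 * Q` steps, where 8 = 4 · 2 comes from `4 * M.card` steps and
`card_plus_le`; the mistake term has factor 3 · 2 = 6 ≤ 8. If there are fewer than `8 * Q` nodes,
selecting all of them is cheap enough. -/
theorem IsSelStarSize.le_eight_mul (hT : T.IsTree) {K t : ℕ} {i : ℕ → V} (hi : IsSelRun T i)
    (ht : IsSelStarSize T K i t) (P : Predictor V) (L : Finset V) {Q : ℕ} (hQ : 1 ≤ Q)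
    (hL : L.card ≤ Q) :
    (t : ℝ) + upsilon T (plus T (firstNodes i t)) K ≤ 8 * (Q + worstMistakes T P L K) := by
  obtain ⟨⟨h1, htn, hmin⟩, -⟩ := ht
  have hlow := upsilon_le_two_mul_worstMistakes hT P L K
  have hnonneg := worstMistakes_nonneg (T := T) P L K
  by_cases hn : 8 * Q ≤ Fintype.card V
  · have hs := hmin (8 * Q) (by omega) hn
    have hcard := card_plus_le hT L
    have hup := hi.upsilon_le hT.isAcyclic (M := plus T L) hn (by omega) K
    have hanti : upsilon T (plus T (firstNodes i (8 * Q))) K ≤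
        upsilon T (firstNodes i (8 * Q)) K := upsilon_anti Finset.subset_union_left
    have : t + upsilon T (plus T (firstNodes i t)) K ≤ 8 * Q + 3 * upsilon T (plus T L) K := by
      omega
    have : (t : ℝ) + upsilon T (plus T (firstNodes i t)) K ≤
        8 * Q + 3 * upsilon T (plus T L) K := by exact_mod_cast this
    linarith
  · have hs := hmin (Fintype.card V) (by omega) le_rfl
    rw [hi.upsilon_card] at hs
    have : t + upsilon T (plus T (firstNodes i t)) K ≤ 8 * Q := by omega
    have : (t : ℝ) + upsilon T (plus T (firstNodes i t)) K ≤ 8 * Q := by exact_mod_cast this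
    linarith

theorem le_qmOpt {K : ℕ} {x : ℝ}
    (h : ∀ (P : Predictor V) (L : Finset V) (Q : ℕ), 1 ≤ Q → L.card ≤ Q →
      x ≤ Q + worstMistakes T P L K) : x ≤ qmOpt T K := by
  -- Needed because an infimum over an empty index type would be 0 in the reals.
  have : Nonempty (Selector V × Predictor V) :=
    ⟨fun _ => ⟨∅, by simp⟩, fun _ _ => PMF.pure fun _ => true⟩
  have : Nonempty {Q : ℕ // 1 ≤ Q} := ⟨⟨1, le_rfl⟩⟩
  exact le_ciInf fun A => le_ciInf fun Q => h A.2 _ Q.1 Q.2 (A.1 Q.1).2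

end

end ActiveTree

theorem mainTheorem6 :
    ∃ c : ℝ, ∀ (V : Type*) [Fintype V] (T : SimpleGraph V), T.IsTree → ∀ K : ℕ,
      ∀ i : ℕ → V, ActiveTree.IsSelRun T i →
      ∀ t : ℕ, ActiveTree.IsSelStarSize T K i t →
      ∀ P : ActiveTree.Predictor V, ActiveTree.IsPred T P →
        ((ActiveTree.firstNodes i t).card : ℝ) +
            ActiveTree.worstMistakes T P (ActiveTree.plus T (ActiveTree.firstNodes i t)) K
          ≤ c * ActiveTree.qmOpt T K ∧
        ((ActiveTree.plus T (ActiveTree.firstNodes i t)).card : ℝ) +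
            ActiveTree.worstMistakes T P (ActiveTree.plus T (ActiveTree.firstNodes i t)) K
          ≤ c * ActiveTree.qmOpt T K := by
  -- 16 = 8 · 2, the factor 2 paying for the added fork nodes.
  refine ⟨16, fun V _ T hT K i hi t ht P hP => ?_⟩
  set L := ActiveTree.firstNodes i t
  have hmis := ActiveTree.worstMistakes_le_upsilon hP
    (ActiveTree.plus_nonempty (ActiveTree.firstNodes_nonempty (i := i) ht.1.1))
    (ActiveTree.isZeroForked_plus hT) K
  have hcard : (L.card : ℝ) ≤ t := by exact_mod_cast ActiveTree.card_firstNodes_le i t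
  have hplus : ((ActiveTree.plus T L).card : ℝ) ≤ 2 * L.card := by
    exact_mod_cast ActiveTree.card_plus_le hT L
  have hopt : ((t : ℝ) + ActiveTree.upsilon T (ActiveTree.plus T L) K) / 8 ≤
      ActiveTree.qmOpt T K := ActiveTree.le_qmOpt fun P L' Q hQ hL' => by
    have := ht.le_eight_mul hT hi P L' hQ hL'
    linarith
  have hnn : (0 : ℝ) ≤ ActiveTree.upsilon T (ActiveTree.plus T L) K := Nat.cast_nonneg _
  constructor <;> linarith
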